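/- There are an absolute constant $C_0>0$ and an integer $N$ such that for all integers $n\ge N$ and $d\ge 1$ with $d\le \sqrt n/\log n$ there exist centered, independent and identically distributed random vectors $\xi_1,\dots,\xi_n$ in $\mathbb{R}^d$ with finite fourth moments (whose distribution may depend on $n$ and $d$), such that $W=\sum_{i=1}^n\xi_i$ satisfies $\mathrm{Var}(W)=I_d$ and $$\sup_{A\in\mathcal A}\bigl|\mathbb P(W\in A)-\mathbb P(Z\in A)\bigr|\;\ge\; C_0\Bigl(\sum_{i=1}^n\mathbb E\bigl[|\xi_i|^4\bigr]\Bigr)^{1/2},$$ where $Z\sim N(0,I_d)$, $\mathcal A$ is the collection of all measurable convex subsets of $\mathbb{R}^d$, and $|\cdot|$ is the Euclidean norm. -/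

import Mathlib

open MeasureTheory ProbabilityTheory

/-- The collection of all measurable convex subsets of `ℝᵈ`. -/
def measurableConvexSets (d : ℕ) : Set (Set (EuclideanSpace ℝ (Fin d))) :=
  {A | MeasurableSet A ∧ Convex ℝ A}

/-- The convex-set distance `sup_A |μ(A) - ν(A)|` of two finite measures on `ℝᵈ`, where `A` ranges
over all measurable convex sets. The supremum is a genuine one, see
`bddAbove_convexSetDist` and `nonempty_measurableConvexSets`. -/
noncomputable def convexSetDist {d : ℕ} (μ ν : Measure (EuclideanSpace ℝ (Fin d))) : ℝ :=
  ⨆ A : measurableConvexSets d, |μ.real (A : Set (EuclideanSpace ℝ (Fin d))) - ν.real A|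

theorem nonempty_measurableConvexSets (d : ℕ) : Nonempty (measurableConvexSets d) :=
  ⟨⟨∅, MeasurableSet.empty, convex_empty⟩⟩

theorem bddAbove_convexSetDist {d : ℕ} (μ ν : Measure (EuclideanSpace ℝ (Fin d)))
    [IsFiniteMeasure μ] [IsFiniteMeasure ν] :
    BddAbove (Set.range fun A : measurableConvexSets d =>
      |μ.real (A : Set (EuclideanSpace ℝ (Fin d))) - ν.real A|) := by
  refine ⟨μ.real Set.univ + ν.real Set.univ, ?_⟩
  rintro _ ⟨A, rfl⟩
  have h1 : μ.real (A : Set (EuclideanSpace ℝ (Fin d))) ≤ μ.real Set.univ :=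
    measureReal_mono (Set.subset_univ _)
  have h2 : ν.real (A : Set (EuclideanSpace ℝ (Fin d))) ≤ ν.real Set.univ :=
    measureReal_mono (Set.subset_univ _)
  have h3 : 0 ≤ μ.real (A : Set (EuclideanSpace ℝ (Fin d))) := measureReal_nonneg
  have h4 : 0 ≤ ν.real (A : Set (EuclideanSpace ℝ (Fin d))) := measureReal_nonneg
  exact abs_le.2 ⟨by linarith, by linarith⟩

/-- The covariance matrix `Var(X)` of a random vector `X` in `ℝᵈ`. -/
noncomputable def covarianceMatrix {Ω : Type*} [MeasurableSpace Ω] {d : ℕ}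
    (X : Ω → EuclideanSpace ℝ (Fin d)) (P : Measure Ω) : Matrix (Fin d) (Fin d) ℝ :=
  Matrix.of fun j k => covariance (fun ω => X ω j) (fun ω => X ω k) P

/-!
The lower bound comes from an atom. Let the law of each summand live on the coordinate axes: with
probability `1 / d ^ 2` it is a symmetric displacement by `d / √n` along one distinguished axis, and
otherwise it is a symmetric displacement of size `d / √((d + 1) n)` along one of the other axes,
chosen uniformly (`signedAxisMeasure`, `exists_axis_weights`). Every axis then contributes the
variance `1 / n`, so the sum `W` of `n` independent copies has identity covariance, while the
fourth moments of the summands add up to at most `2 * d ^ 2 / n`.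

The distinguished coordinate of `W` has variance one and takes values in the lattice `(d / √n) ℤ`,
whose spacing is at most one because `d ≤ √n`. By Chebyshev's inequality at most `5 √n / d` lattice points carry
three quarters of its mass, so one of them has mass at least a constant times `d / √n`
(`exists_le_measureReal_eq_mul_int`). The corresponding hyperplane is convex and has Gaussian
measure zero, so the convex distance is at least the mass of that atom
(`measureReal_eval_eq_le_convexSetDist`), which is of the order of the square root of the sum of the
fourth moments.
-/

/-! ### Symmetric laws on the coordinate axes -/

/-- The law on `ℝᵈ` of the random vector `± s j • e j`, where the axis `j` is drawn with
probability `q j` and the sign is a fair coin. The weights enter through `ENNReal.ofReal`, so the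
intended use is with `0 ≤ q j`. -/
noncomputable def signedAxisMeasure {d : ℕ} (q s : Fin d → ℝ) :
    Measure (EuclideanSpace ℝ (Fin d)) :=
  ∑ j, ENNReal.ofReal (q j / 2) •
    (Measure.dirac (PiLp.single 2 j (s j)) + Measure.dirac (PiLp.single 2 j (-s j)))

section signedAxisMeasure

variable {d : ℕ} {q s : Fin d → ℝ}

theorem integrable_signedAxisMeasure {F : Type*} [NormedAddCommGroup F]
    (f : EuclideanSpace ℝ (Fin d) → F) : Integrable f (signedAxisMeasure q s) := by
  rw [signedAxisMeasure, integrable_finsetSum_measure]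
  intro j _
  exact ((integrable_dirac (by simp)).add_measure (integrable_dirac (by simp))).smul_measure
    ENNReal.ofReal_ne_top

theorem integral_signedAxisMeasure (hq : ∀ j, 0 ≤ q j) (f : EuclideanSpace ℝ (Fin d) → ℝ) :
    ∫ x, f x ∂signedAxisMeasure q s =
      ∑ j, q j / 2 * (f (PiLp.single 2 j (s j)) + f (PiLp.single 2 j (-s j))) := by
  rw [signedAxisMeasure, integral_finsetSum_measure]
  · refine Finset.sum_congr rfl fun j _ => ?_
    rw [integral_smul_measure,
      integral_add_measure (integrable_dirac (by simp)) (integrable_dirac (by simp)),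
      integral_dirac, integral_dirac, ENNReal.toReal_ofReal (by linarith [hq j]), smul_eq_mul]
  · intro j _
    exact ((integrable_dirac (by simp)).add_measure (integrable_dirac (by simp))).smul_measure
      ENNReal.ofReal_ne_top

theorem ae_signedAxisMeasure {p : EuclideanSpace ℝ (Fin d) → Prop}
    (h : ∀ j, p (PiLp.single 2 j (s j))) (h' : ∀ j, p (PiLp.single 2 j (-s j))) :
    ∀ᵐ x ∂signedAxisMeasure q s, p x := by
  rw [signedAxisMeasure, ae_finsetSum_measure_iff]
  intro j _
  refine Measure.ae_smul_measure ?_ _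
  rw [ae_add_measure_iff, ae_dirac_eq, ae_dirac_eq]
  exact ⟨h j, h' j⟩

theorem isProbabilityMeasure_signedAxisMeasure (hq : ∀ j, 0 ≤ q j) (hsum : ∑ j, q j = 1) :
    IsProbabilityMeasure (signedAxisMeasure q s) := by
  refine ⟨?_⟩
  have h : ∀ j, ENNReal.ofReal (q j / 2) * (1 + 1) = ENNReal.ofReal (q j) := fun j => by
    rw [mul_add, mul_one, ← ENNReal.ofReal_add (by linarith [hq j]) (by linarith [hq j]),
      add_halves]
  simp only [signedAxisMeasure, Measure.finsetSum_apply, Measure.smul_apply, Measure.add_apply,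
    measure_univ, smul_eq_mul, h]
  rw [← ENNReal.ofReal_sum_of_nonneg fun j _ => hq j, hsum, ENNReal.ofReal_one]

theorem memLp_id_signedAxisMeasure {p : ENNReal} (h0 : p ≠ 0) (htop : p ≠ ⊤) :
    MemLp (fun x => x) p (signedAxisMeasure q s) :=
  (integrable_norm_rpow_iff aestronglyMeasurable_id h0 htop).1 (integrable_signedAxisMeasure _)

theorem integral_id_signedAxisMeasure (hq : ∀ j, 0 ≤ q j) :
    ∫ x, x ∂signedAxisMeasure q s = 0 := by
  ext i
  rw [eval_integral_piLp fun i => integrable_signedAxisMeasure _, integral_signedAxisMeasure hq]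
  simp only [PiLp.single_apply, PiLp.zero_apply]
  exact Finset.sum_eq_zero fun j _ => by split_ifs <;> ring

theorem integral_eval_signedAxisMeasure (hq : ∀ j, 0 ≤ q j) (i : Fin d) :
    ∫ x, x i ∂signedAxisMeasure q s = 0 := by
  rw [← eval_integral_piLp fun i => integrable_signedAxisMeasure _,
    integral_id_signedAxisMeasure hq, PiLp.zero_apply]

theorem covariance_eval_signedAxisMeasure (hq : ∀ j, 0 ≤ q j) (i k : Fin d) :
    cov[fun x => x i, fun x => x k; signedAxisMeasure q s] =
      if i = k then q i * s i ^ 2 else 0 := by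
  simp only [covariance, integral_eval_signedAxisMeasure hq, sub_zero]
  rw [integral_signedAxisMeasure hq]
  simp only [PiLp.single_apply]
  split_ifs with h
  · subst h
    rw [Finset.sum_eq_single i]
    · simp only [if_true]
      ring
    · intro j _ hj
      simp [hj.symm]
    · simp
  · refine Finset.sum_eq_zero fun j _ => ?_
    by_cases hi : i = j
    · have hk : k ≠ j := fun hk => h (hi.trans hk.symm)
      simp [hk]
    · simp [hi]

theorem integral_norm_pow_four_signedAxisMeasure (hq : ∀ j, 0 ≤ q j) :
    ∫ x, ‖x‖ ^ 4 ∂signedAxisMeasure q s = ∑ j, q j * s j ^ 4 := by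
  rw [integral_signedAxisMeasure hq]
  refine Finset.sum_congr rfl fun j _ => ?_
  have h4 : ∀ x : ℝ, |x| ^ 4 = x ^ 4 := fun x => Even.pow_abs (by decide) x
  simp only [PiLp.norm_single, norm_neg, Real.norm_eq_abs, h4]
  ring

end signedAxisMeasure

/-! ### A large atom for lattice variables -/

/-- By Chebyshev's inequality the interval `(-2, 2)` carries mass at least `3 / 4`, and it meets
the lattice `h ℤ` in at most `5 / h` points, so one of these is heavy. -/
theorem exists_le_measureReal_eq_mul_int {Ω : Type*} [MeasurableSpace Ω] {P : Measure Ω}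
    [IsProbabilityMeasure P] {X : Ω → ℝ} {h : ℝ} (hX : Measurable X) (hX2 : MemLp X 2 P)
    (hmean : ∫ ω, X ω ∂P = 0) (hvar : Var[X; P] ≤ 1) (h0 : 0 < h) (h1 : h ≤ 1)
    (hlat : ∀ᵐ ω ∂P, ∃ k : ℤ, X ω = h * k) :
    ∃ k : ℤ, 3 / 20 * h ≤ P.real {ω | X ω = h * k} := by
  set m : ℕ := ⌊2 / h⌋₊
  have hm : (m : ℝ) ≤ 2 / h := Nat.floor_le (by positivity)
  set T : Finset ℤ := Finset.Icc (-(m : ℤ)) m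
  have hcard : (T.card : ℝ) * h ≤ 5 := by
    have : T.card = 2 * m + 1 := by
      rw [Int.card_Icc]
      omega
    rw [this]
    push_cast
    have := (le_div_iff₀ h0).1 hm
    linarith
  have hcheb : P.real {ω | 2 ≤ |X ω|} ≤ 1 / 4 := by
    have := meas_ge_le_variance_div_sq hX2 (c := 2) (by norm_num)
    simp only [hmean, sub_zero] at this
    refine ENNReal.toReal_le_of_le_ofReal (by norm_num) (this.trans ?_)
    exact ENNReal.ofReal_le_ofReal (by linarith)
  have hmass : 3 / 4 ≤ P.real {ω | |X ω| < 2} := by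
    have hms : MeasurableSet {ω | 2 ≤ |X ω|} := measurableSet_le measurable_const hX.abs
    have heq : {ω | |X ω| < 2} = {ω | 2 ≤ |X ω|}ᶜ := by
      ext ω
      simp
    rw [heq, probReal_compl_eq_one_sub hms]
    linarith
  have hcover : P.real {ω | |X ω| < 2} ≤ P.real (⋃ k ∈ T, {ω | X ω = h * k}) := by
    refine ENNReal.toReal_mono (measure_ne_top _ _) (measure_mono_ae ?_)
    filter_upwards [hlat] with ω ⟨k, hk⟩ hω
    have hω' : |X ω| < 2 := hω
    have hkm : k.natAbs ≤ m := by
      refine Nat.le_floor ?_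
      rw [le_div_iff₀ h0, Nat.cast_natAbs, Int.cast_abs]
      rw [hk, abs_mul, abs_of_pos h0] at hω'
      linarith
    have hkT : k ∈ T := Finset.mem_Icc.2 (by omega)
    exact Set.mem_biUnion hkT hk
  by_contra! hcon
  have hT : (0 : ℤ) ∈ T := Finset.mem_Icc.2 (by omega)
  have hlt : ∑ k ∈ T, P.real {ω | X ω = h * k} < T.card * (3 / 20 * h) := by
    rw [← nsmul_eq_mul, ← Finset.sum_const]
    exact Finset.sum_lt_sum_of_nonempty ⟨0, hT⟩ fun k _ => hcon k
  have := measureReal_biUnion_finset_le (μ := P) T fun k : ℤ => {ω | X ω = h * k}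
  linarith

/-! ### Gaussian measure of hyperplanes -/

theorem stdGaussian_setOf_eval_eq {d : ℕ} (i : Fin d) (c : ℝ) :
    multivariateGaussian (0 : EuclideanSpace ℝ (Fin d)) 1 {x | x i = c} = 0 := by
  have hmp := measurePreserving_eval_multivariateGaussian (μ := (0 : EuclideanSpace ℝ (Fin d)))
    Matrix.PosSemidef.one (i := i)
  have h := hmp.measure_preimage (measurableSet_singleton c).nullMeasurableSet
  have : NullSingletonClass (gaussianReal ((0 : EuclideanSpace ℝ (Fin d)) i)
      ((1 : Matrix (Fin d) (Fin d) ℝ) i i).toNNReal) :=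
    nullSingletonClass_gaussianReal (by simp)
  rw [measure_singleton] at h
  exact h

theorem setOf_eval_eq_mem_measurableConvexSets {d : ℕ} (i : Fin d) (c : ℝ) :
    {x : EuclideanSpace ℝ (Fin d) | x i = c} ∈ measurableConvexSets d :=
  ⟨measurableSet_eq_fun (by fun_prop) measurable_const,
    (convex_singleton c).linear_preimage (EuclideanSpace.proj i : _ →L[ℝ] ℝ).toLinearMap⟩

/-- A law with an atom in one coordinate is as far from the standard Gaussian law as that atom is
heavy, since the hyperplane carrying it is convex and Gaussian-null. -/
theorem measureReal_eval_eq_le_convexSetDist {d : ℕ} {Ω : Type*} [MeasurableSpace Ω]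
    {P : Measure Ω} [IsProbabilityMeasure P] {W : Ω → EuclideanSpace ℝ (Fin d)}
    (hW : Measurable W) (i : Fin d) (c : ℝ) :
    P.real {ω | W ω i = c} ≤
      convexSetDist (P.map W) (multivariateGaussian (0 : EuclideanSpace ℝ (Fin d)) 1) := by
  have := Measure.isProbabilityMeasure_map (μ := P) hW.aemeasurable
  have hA := setOf_eval_eq_mem_measurableConvexSets i c
  refine le_trans ?_ (le_ciSup (bddAbove_convexSetDist _ _) ⟨_, hA⟩)
  have hG : (multivariateGaussian (0 : EuclideanSpace ℝ (Fin d)) 1).real {x | x i = c} = 0 := by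
    rw [measureReal_def, stdGaussian_setOf_eval_eq, ENNReal.toReal_zero]
  simp only [hG, sub_zero, map_measureReal_apply hW hA.1]
  exact le_abs_self _

/-! ### Sums of independent copies -/

section iidSum

variable {d n : ℕ} {μ : Measure (EuclideanSpace ℝ (Fin d))} [IsProbabilityMeasure μ]

theorem memLp_eval_pi {p : ENNReal} (h : MemLp (fun x => x) p μ) (i : Fin n) :
    MemLp (fun ω : Fin n → EuclideanSpace ℝ (Fin d) => ω i) p (Measure.pi fun _ => μ) :=
  h.comp_measurePreserving (measurePreserving_eval (fun _ => μ) i)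

theorem memLp_eval_eval_pi {p : ENNReal} (h : MemLp (fun x => x) p μ) (i : Fin n) (j : Fin d) :
    MemLp (fun ω : Fin n → EuclideanSpace ℝ (Fin d) => ω i j) p (Measure.pi fun _ => μ) :=
  (EuclideanSpace.proj j : EuclideanSpace ℝ (Fin d) →L[ℝ] ℝ).comp_memLp' (memLp_eval_pi h i)

theorem integral_comp_eval_pi {F : Type*} [NormedAddCommGroup F] [NormedSpace ℝ F]
    {f : EuclideanSpace ℝ (Fin d) → F} (hf : AEStronglyMeasurable f μ) (i : Fin n) :
    ∫ ω, f (ω i) ∂(Measure.pi fun _ : Fin n => μ) = ∫ x, f x ∂μ := by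
  have h := (measurePreserving_eval (fun _ : Fin n => μ) i)
  rw [← h.map_eq] at hf
  have := integral_map h.measurable.aemeasurable hf
  rw [h.map_eq] at this
  exact this.symm

theorem iIndepFun_eval_pi :
    iIndepFun (fun (i : Fin n) (ω : Fin n → EuclideanSpace ℝ (Fin d)) => ω i)
      (Measure.pi fun _ => μ) :=
  iIndepFun_pi (X := fun _ x => x) fun _ => aemeasurable_id

theorem covarianceMatrix_sum_pi (h : MemLp (fun x => x) 2 μ) :
    covarianceMatrix (fun ω : Fin n → EuclideanSpace ℝ (Fin d) => ∑ i, ω i)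
      (Measure.pi fun _ => μ) = (n : ℝ) • covarianceMatrix (fun x => x) μ := by
  ext j k
  simp only [covarianceMatrix, Matrix.of_apply, Matrix.smul_apply, smul_eq_mul, WithLp.ofLp_sum,
    Finset.sum_apply]
  rw [covariance_fun_sum_fun_sum (fun i => memLp_eval_eval_pi h i j)
    (fun i => memLp_eval_eval_pi h i k)]
  have hcov : ∀ i l : Fin n, cov[fun ω : Fin n → EuclideanSpace ℝ (Fin d) => ω i j,
      fun ω => ω l k; Measure.pi fun _ => μ] =
      if i = l then cov[fun x => x j, fun x => x k; μ] else 0 := by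
    intro i l
    split_ifs with hil
    · subst hil
      have hmp := measurePreserving_eval (fun _ : Fin n => μ) i
      have := covariance_map_fun (μ := Measure.pi fun _ : Fin n => μ) (Z := Function.eval i)
        (X := fun x : EuclideanSpace ℝ (Fin d) => x j) (Y := fun x => x k)
        (by fun_prop) (by fun_prop) hmp.measurable.aemeasurable
      rw [hmp.map_eq] at this
      exact this.symm
    · have hind := (iIndepFun_eval_pi (μ := μ) (n := n)).indepFun hil
      exact (hind.comp (φ := fun x : EuclideanSpace ℝ (Fin d) => x j)
        (ψ := fun x : EuclideanSpace ℝ (Fin d) => x k) (by fun_prop)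
        (by fun_prop)).covariance_eq_zero (memLp_eval_eval_pi h i j) (memLp_eval_eval_pi h l k)
  simp [hcov]

end iidSum

/-! ### The extremal law -/

/-- The weights put mass `1 / d ^ 2` on one axis and share the rest equally, which forces the
displacement `d / √n` on that axis and `d / √((d + 1) n)` on the others. The total of the fourth
moments stays of the order `d ^ 2 / n ^ 2`. -/
theorem exists_axis_weights {n d : ℕ} (hn : 0 < n) (i₀ : Fin d) :
    ∃ q s : Fin d → ℝ, (∀ j, 0 ≤ q j) ∧ ∑ j, q j = 1 ∧ (∀ j, q j * s j ^ 2 = 1 / n) ∧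
      s i₀ = d / √n ∧ ∑ j, q j * s j ^ 4 ≤ 2 * (d : ℝ) ^ 2 / n ^ 2 := by
  have hn' : (0 : ℝ) < n := by exact_mod_cast hn
  have hd : (1 : ℝ) ≤ d := by exact_mod_cast Fin.pos i₀
  have hd0 : (d : ℝ) ≠ 0 := by positivity
  have hsum : ∀ a b : ℝ, ∑ j, (if j = i₀ then a else b) = a + (d - 1) * b := by
    intro a b
    have : ∀ j, (if j = i₀ then a else b) = b + if j = i₀ then a - b else 0 := fun j => by
      split_ifs <;> ring
    simp only [this, Finset.sum_add_distrib, Finset.sum_ite_eq', Finset.mem_univ, if_true,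
      Finset.sum_const, Finset.card_univ, Fintype.card_fin, nsmul_eq_mul]
    ring
  set q : Fin d → ℝ := fun j => if j = i₀ then 1 / (d : ℝ) ^ 2 else (d + 1) / (d : ℝ) ^ 2
  set s : Fin d → ℝ := fun j => if j = i₀ then d / √n else √((d : ℝ) ^ 2 / ((d + 1) * n))
  have hs2 : ∀ j, s j ^ 2 = if j = i₀ then (d : ℝ) ^ 2 / n else (d : ℝ) ^ 2 / ((d + 1) * n) := by
    intro j
    simp only [s]
    split_ifs
    · rw [div_pow, Real.sq_sqrt hn'.le]
    · rw [Real.sq_sqrt (by positivity)]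
  have hqs : ∀ j, q j * s j ^ 2 = 1 / n := by
    intro j
    rw [hs2]
    simp only [q]
    split_ifs <;> field_simp
  refine ⟨q, s, fun j => ?_, ?_, hqs, by simp [s], ?_⟩
  · simp only [q]
    split_ifs <;> positivity
  · rw [hsum]
    field_simp
    ring
  · have h4 : ∀ j, q j * s j ^ 4 = 1 / n * s j ^ 2 := fun j => by
      rw [← hqs j]
      ring
    simp only [h4]
    rw [← Finset.mul_sum]
    simp only [hs2]
    rw [hsum]
    have hle : (d - 1) * ((d : ℝ) ^ 2 / ((d + 1) * n)) ≤ (d : ℝ) ^ 2 / n := by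
      rw [mul_div_assoc', div_le_div_iff₀ (by positivity) hn']
      have : 0 ≤ (d : ℝ) ^ 2 * n := by positivity
      linarith
    calc 1 / (n : ℝ) * ((d : ℝ) ^ 2 / n + (d - 1) * ((d : ℝ) ^ 2 / ((d + 1) * n)))
        ≤ 1 / (n : ℝ) * ((d : ℝ) ^ 2 / n + (d : ℝ) ^ 2 / n) := by gcongr
      _ = 2 * (d : ℝ) ^ 2 / n ^ 2 := by
        field_simp
        ring

theorem exists_int_eval_eq_signedAxisMeasure {d : ℕ} {q s : Fin d → ℝ} (i₀ : Fin d) :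
    ∀ᵐ x ∂signedAxisMeasure q s, ∃ k : ℤ, x i₀ = s i₀ * k := by
  refine ae_signedAxisMeasure (fun j => ?_) fun j => ?_
  · by_cases h : i₀ = j
    · subst h
      exact ⟨1, by simp⟩
    · exact ⟨0, by simp [h]⟩
  · by_cases h : i₀ = j
    · subst h
      exact ⟨-1, by simp⟩
    · exact ⟨0, by simp [h]⟩

theorem mainTheorem4 :
    ∃ C₀ : ℝ, 0 < C₀ ∧ ∃ N : ℕ, ∀ n d : ℕ, N ≤ n → 1 ≤ d →
      (d : ℝ) ≤ Real.sqrt (n : ℝ) / Real.log (n : ℝ) →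
      ∃ (Ω : Type) (_ : MeasurableSpace Ω) (P : Measure Ω) (_ : IsProbabilityMeasure P)
        (ξ : Fin n → Ω → EuclideanSpace ℝ (Fin d)),
        (∀ i, Measurable (ξ i)) ∧
        iIndepFun ξ P ∧
        (∀ i j, IdentDistrib (ξ i) (ξ j) P P) ∧
        (∀ i, MemLp (ξ i) 4 P) ∧
        (∀ i, ∫ ω, ξ i ω ∂P = 0) ∧
        covarianceMatrix (fun ω => ∑ i, ξ i ω) P = 1 ∧
        C₀ * Real.sqrt (∑ i, ∫ ω, ‖ξ i ω‖ ^ 4 ∂P) ≤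
          convexSetDist (P.map fun ω => ∑ i, ξ i ω)
            (multivariateGaussian (0 : EuclideanSpace ℝ (Fin d)) 1) := by
  -- With `h = d / √n` the atom has mass at least `3 / 20 * h`, and the fourth moments sum to at
  -- most `2 * h ^ 2 ≤ (2 * h) ^ 2`.
  refine ⟨3 / 40, by norm_num, 3, fun n d hn hd hdn => ?_⟩
  have hn' : (0 : ℝ) < n := by
    have : 0 < n := by omega
    exact_mod_cast this
  -- For `n ≥ 3` the logarithm exceeds `1`, so `d ≤ √n` and the lattice spacing is at most `1`.
  have hlog : 1 ≤ Real.log n := by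
    rw [Real.le_log_iff_exp_le hn']
    have : (3 : ℝ) ≤ n := by exact_mod_cast hn
    linarith [Real.exp_one_lt_three]
  have hd_sqrt : (d : ℝ) ≤ √n := hdn.trans (div_le_self (Real.sqrt_nonneg _) hlog)
  have hd' : (0 : ℝ) < d := by exact_mod_cast hd
  set i₀ : Fin d := ⟨0, hd⟩
  obtain ⟨q, s, hq, hq1, hqs, hs0, hfour⟩ := exists_axis_weights (n := n) (by omega) i₀
  set μ := signedAxisMeasure q s
  have hμ : IsProbabilityMeasure μ := isProbabilityMeasure_signedAxisMeasure hq hq1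
  have hL2 : MemLp (fun x => x) 2 μ := memLp_id_signedAxisMeasure (by norm_num) (by norm_num)
  have hL4 : MemLp (fun x => x) 4 μ := memLp_id_signedAxisMeasure (by norm_num) (by norm_num)
  set P : Measure (Fin n → EuclideanSpace ℝ (Fin d)) := Measure.pi fun _ => μ
  have hmp : ∀ i : Fin n, P.map (fun ω => ω i) = μ := fun i =>
    (measurePreserving_eval (fun _ => μ) i).map_eq
  have hcov : covarianceMatrix (fun ω : Fin n → EuclideanSpace ℝ (Fin d) => ∑ i, ω i) P = 1 := by
    rw [covarianceMatrix_sum_pi hL2]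
    ext j k
    simp only [covarianceMatrix, Matrix.smul_apply, Matrix.of_apply, smul_eq_mul, μ,
      covariance_eval_signedAxisMeasure hq, hqs, Matrix.one_apply]
    split_ifs
    · field_simp
    · simp
  have hmeas : Measurable fun ω : Fin n → EuclideanSpace ℝ (Fin d) => ∑ i, ω i := by fun_prop
  refine ⟨_, _, P, inferInstance, fun i ω => ω i, fun i => by fun_prop, iIndepFun_eval_pi,
    fun i j => ⟨(measurable_pi_apply i).aemeasurable, (measurable_pi_apply j).aemeasurable,
      by rw [hmp, hmp]⟩, fun i => memLp_eval_pi hL4 i,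
    fun i => ?_, hcov, ?_⟩
  · rw [integral_comp_eval_pi (f := fun x => x) hL2.1, integral_id_signedAxisMeasure hq]
  have hsqrt : √(∑ i : Fin n, ∫ ω, ‖ω i‖ ^ 4 ∂P) ≤ 2 * (d / √n) := by
    have hint : ∀ i : Fin n, ∫ ω, ‖ω i‖ ^ 4 ∂P = ∑ j, q j * s j ^ 4 := fun i => by
      rw [integral_comp_eval_pi (f := fun x => ‖x‖ ^ 4) (by fun_prop),
        integral_norm_pow_four_signedAxisMeasure hq]
    simp only [hint, Finset.sum_const, Finset.card_univ, Fintype.card_fin, nsmul_eq_mul]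
    rw [Real.sqrt_le_left (by positivity), mul_pow, div_pow, Real.sq_sqrt hn'.le]
    calc (n : ℝ) * ∑ j, q j * s j ^ 4 ≤ n * (2 * (d : ℝ) ^ 2 / n ^ 2) := by gcongr
      _ = 2 * ((d : ℝ) ^ 2 / n) := by field_simp
      _ ≤ 2 ^ 2 * ((d : ℝ) ^ 2 / n) := by
        gcongr
        norm_num
  have hWL2 : MemLp (fun ω : Fin n → EuclideanSpace ℝ (Fin d) => (∑ i, ω i) i₀) 2 P := by
    simp only [WithLp.ofLp_sum, Finset.sum_apply]
    exact memLp_finsetSum _ fun i _ => memLp_eval_eval_pi hL2 i i₀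
  have hmean : ∫ ω : Fin n → EuclideanSpace ℝ (Fin d), (∑ i, ω i) i₀ ∂P = 0 := by
    simp only [WithLp.ofLp_sum, Finset.sum_apply]
    rw [integral_finsetSum _ fun i _ => (memLp_eval_eval_pi hL2 i i₀).integrable (by norm_num)]
    refine Finset.sum_eq_zero fun i _ => ?_
    rw [integral_comp_eval_pi (f := fun x => x i₀) (by fun_prop),
      integral_eval_signedAxisMeasure hq]
  have hvar : Var[fun ω : Fin n → EuclideanSpace ℝ (Fin d) => (∑ i, ω i) i₀; P] = 1 := by
    rw [← covariance_self (by fun_prop)]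
    simpa [covarianceMatrix] using congrFun (congrFun hcov i₀) i₀
  have hlat : ∀ᵐ ω ∂P, ∃ k : ℤ, (∑ i, ω i) i₀ = d / √n * k := by
    have hall : ∀ᵐ ω ∂P, ∀ i : Fin n, ∃ k : ℤ, ω i i₀ = s i₀ * k := ae_all_iff.2 fun i =>
      (measurePreserving_eval (fun _ => μ) i).quasiMeasurePreserving.ae
        (exists_int_eval_eq_signedAxisMeasure i₀)
    filter_upwards [hall] with ω hω
    choose k hk using hω
    refine ⟨∑ i, k i, ?_⟩
    simp only [WithLp.ofLp_sum, Finset.sum_apply, hk, hs0]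
    push_cast
    rw [Finset.mul_sum]
  obtain ⟨k, hk⟩ := exists_le_measureReal_eq_mul_int (by fun_prop) hWL2 hmean hvar.le
    (by positivity) ((div_le_one (by positivity)).2 hd_sqrt) hlat
  refine le_trans ?_ (hk.trans (measureReal_eval_eq_le_convexSetDist hmeas i₀ _))
  linarith
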